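/- **Theorem (Mermin Locality).** Let $\mathcal C$ be a $\dagger$-symmetric monoidal category ($\dagger$-SMC: the dagger is monoidal and all structural isomorphisms are unitary). Suppose that for every object $A$ and every strongly complementary pair $(Z,X)$ of $\dagger$-qSCFAs on $A$, the group $P_Z$ of $Z$-phases is a trivial algebraic extension of the subgroup $K_X\le P_Z$ of $X$-classical points. Then $\mathcal C$ is Mermin local: every Mermin measurement scenario, for every strongly complementary pair of $\dagger$-qSCFAs in $\mathcal C$, has a local hidden variable model. The terms are as follows. * A *$\dagger$-qSCFA* $Z$ on $A$ is a commutative monoid $(\mu_Z,\eta_Z)$ on $A$ which, with $\Delta_Z=\mu_Z^\dagger$ and $\epsilon_Z=\eta_Z^\dagger$, satisfies the Frobenius law $(\mathrm{id}\otimes\mu_Z)(\Delta_Z\otimes \mathrm{id})=\Delta_Z\mu_Z=(\mu_Z\otimes \mathrm{id})(\mathrm{id}\otimes\Delta_Z)$ and for which $\mu_Z\Delta_Z$ is an invertible scalar times $\mathrm{id}_A$. * $(Z,X)$ is *strongly complementary* if, with $\sigma$ the symmetry, $\Delta_Z\mu_X=(\mu_X\otimes\mu_X)(\mathrm{id}\otimes\sigma\otimes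 \mathrm{id})(\Delta_Z\otimes\Delta_Z)$, $\;\Delta_Z\eta_X=\eta_X\otimes\eta_X$ and $\epsilon_Z\mu_X=\epsilon_Z\otimes\epsilon_Z$. * A *$Z$-phase* (state) is $\alpha:I\to A$ with $(\alpha^\dagger\otimes \mathrm{id})\Delta_Z\alpha=\eta_Z$. The phases form an abelian group $P_Z$ with $\alpha+\beta=\mu_Z(\alpha\otimes\beta)$ and zero $\eta_Z$; the phase $\alpha$ acts on $A$ as the map $\mu_Z(\alpha\otimes \mathrm{id})$. $K_X\le P_Z$ is the subgroup of those phases $c$ that are copied by $X$, i.e. $\Delta_X c=c\otimes c$. * An abelian group $G$ is a *trivial algebraic extension* of a subgroup $H$ if every finite system of equations $\sum_{j=1}^l n^p_j x_j=h^p$ with $n^p_j\in\mathbb Z$ and $h^p\in H$ that has a solution in $G$ has a solution in $H$. * For a tuple $\alpha=(\alpha_1,\dots,\alpha_N)$ of $Z$-phases, let $\psi_\alpha:I\to A^{\otimes N}$ be the $N$-partite GHZ state ($\eta_Z$ followed by the $Z$-node with $N$ outputs) with $\alpha_i$ applied to its $i$-th component. The outcome of measuring each component in $X$ is the state $\mathcal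 M(\alpha)=(\psi_\alpha^\dagger\otimes \mathrm{id})\,\Delta_X^{(N)}\,\psi_\alpha : I\to A^{\otimes N}$, where $\Delta_X^{(N)}:A^{\otimes N}\to A^{\otimes N}\otimes A^{\otimes N}$ applies $\Delta_X$ to every component. It is called a *Mermin measurement* if $\sum_i\alpha_i\in K_X$. An $N$-partite *Mermin measurement scenario* is a non-empty finite family $(\alpha^s)_{s=1,\dots,S}$ of $N$-tuples of $Z$-phases with $\sum_i\alpha^s_i\in K_X$ for every $s$. * Let $a_1,\dots,a_M$ be the distinct phases appearing in a scenario. Its *local map* $L:A^{\otimes (M\cdot N)}\to A^{\otimes (N\cdot S)}$ has input wires indexed by pairs (system $i$, phase $a_r$) and output wires indexed by pairs (measurement $s$, system $j$). Each input wire $(i,a_r)$ enters an $X$-node (built from $\Delta_X$ and $\epsilon_X$) whose outputs are exactly the output wires $(s,j)$ with $j=i$ and $\alpha^s_j=a_r$. A *local hidden variable model* for the scenario is a state $L\Lambda'$, for some state $\Lambda':I\to A^{\otimes (M\cdot N)}$, such that for every $s$, applying $\epsilon_X$ to all the output wires of $L\Lambda'$ that belong to measurements $t\ne s$ gives $\mathcal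 M(\alpha^s)$. -/

import Mathlib

open CategoryTheory MonoidalCategory

universe v u

namespace Mermin

/-! ### Dagger symmetric monoidal categories -/

/-- A dagger on a symmetric monoidal category: an involutive, identity-on-objects contravariant
functor that is strict monoidal and for which all structural isomorphisms are unitary. -/
class DaggerSMC (C : Type u) [Category.{v} C] [MonoidalCategory C] [SymmetricCategory C] where
  dagger : ∀ {A B : C}, (A ⟶ B) → (B ⟶ A)
  dagger_id : ∀ A : C, dagger (𝟙 A) = 𝟙 A
  dagger_comp : ∀ {A B D : C} (f : A ⟶ B) (g : B ⟶ D), dagger (f ≫ g) = dagger g ≫ dagger f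
  dagger_dagger : ∀ {A B : C} (f : A ⟶ B), dagger (dagger f) = f
  dagger_tensor : ∀ {A B A' B' : C} (f : A ⟶ B) (g : A' ⟶ B'),
    dagger (f ⊗ₘ g) = dagger f ⊗ₘ dagger g
  dagger_associator : ∀ A B D : C, dagger (α_ A B D).hom = (α_ A B D).inv
  dagger_leftUnitor : ∀ A : C, dagger (λ_ A).hom = (λ_ A).inv
  dagger_rightUnitor : ∀ A : C, dagger (ρ_ A).hom = (ρ_ A).inv
  dagger_braiding : ∀ A B : C, dagger (β_ A B).hom = (β_ A B).inv

section Basics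

variable {C : Type u} [Category.{v} C] [MonoidalCategory C] [SymmetricCategory C] [DaggerSMC C]

/-- The adjoint (dagger) of a morphism. -/
def dag {A B : C} (f : A ⟶ B) : B ⟶ A := DaggerSMC.dagger f

theorem dag_id (A : C) : dag (𝟙 A) = 𝟙 A := DaggerSMC.dagger_id A

theorem dag_comp {A B D : C} (f : A ⟶ B) (g : B ⟶ D) : dag (f ≫ g) = dag g ≫ dag f :=
  DaggerSMC.dagger_comp f g

theorem dag_dag {A B : C} (f : A ⟶ B) : dag (dag f) = f := DaggerSMC.dagger_dagger f

theorem dag_tensor {A B A' B' : C} (f : A ⟶ B) (g : A' ⟶ B') :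
    dag (f ⊗ₘ g) = dag f ⊗ₘ dag g := DaggerSMC.dagger_tensor f g

theorem dag_whiskerRight {A B : C} (f : A ⟶ B) (D : C) : dag (f ▷ D) = dag f ▷ D := by
  rw [← tensorHom_id, dag_tensor, dag_id, tensorHom_id]

theorem dag_whiskerLeft {A B : C} (D : C) (f : A ⟶ B) : dag (D ◁ f) = D ◁ dag f := by
  rw [← id_tensorHom, dag_tensor, dag_id, id_tensorHom]

theorem dag_associator (A B D : C) : dag (α_ A B D).hom = (α_ A B D).inv :=
  DaggerSMC.dagger_associator A B D

theorem dag_associator_inv (A B D : C) : dag (α_ A B D).inv = (α_ A B D).hom := by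
  rw [← dag_associator, dag_dag]

theorem dag_leftUnitor (A : C) : dag (λ_ A).hom = (λ_ A).inv := DaggerSMC.dagger_leftUnitor A

theorem dag_leftUnitor_inv (A : C) : dag (λ_ A).inv = (λ_ A).hom := by
  rw [← dag_leftUnitor, dag_dag]

theorem dag_braiding (A B : C) : dag (β_ A B).hom = (β_ A B).inv :=
  DaggerSMC.dagger_braiding A B

theorem dag_tensorμ (A B D E : C) :
    dag (tensorμ A B D E) = tensorμ A D B E := by
  simp only [tensorμ, dag_comp, dag_whiskerLeft, dag_whiskerRight, dag_associator,
    dag_associator_inv, dag_braiding, Category.assoc]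
  rw [SymmetricCategory.braiding_swap_eq_inv_braiding B D, ← dag_braiding]

/-! ### Quasi-special commutative dagger Frobenius algebras -/

/-- A quasi-special commutative `†`-Frobenius algebra on `A`: a commutative monoid (its comonoid
is the dagger of the monoid) satisfying the Frobenius law, and such that comultiplication followed
by multiplication is an invertible scalar times the identity. -/
structure DaggerQSCFA (A : C) extends MonObj A where
  mul_comm : (β_ A A).hom ≫ mul = mul
  frobenius_left : A ◁ dag mul ≫ (α_ A A A).inv ≫ mul ▷ A = mul ≫ dag mul
  frobenius_right : dag mul ▷ A ≫ (α_ A A A).hom ≫ A ◁ mul = mul ≫ dag mul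
  quasiSpecial : ∃ N : 𝟙_ C ⟶ 𝟙_ C, IsIso N ∧
    dag mul ≫ mul = (λ_ A).inv ≫ N ▷ A ≫ (λ_ A).hom

namespace DaggerQSCFA

variable {A : C}

/-- The comultiplication, i.e. the dagger of the multiplication. -/
def comul (Z : DaggerQSCFA A) : A ⟶ A ⊗ A := dag Z.mul

/-- The counit, i.e. the dagger of the unit. -/
def counit (Z : DaggerQSCFA A) : A ⟶ 𝟙_ C := dag Z.one

/-- The endomorphism of `A` given by multiplying by the state `a`. -/
def phaseMap (Z : DaggerQSCFA A) (a : 𝟙_ C ⟶ A) : A ⟶ A :=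
  (λ_ A).inv ≫ a ▷ A ≫ Z.mul

end DaggerQSCFA

/-- A strongly complementary pair: the multiplication of `X` and the comultiplication of `Z`
satisfy the bialgebra equation, and the unit of `X` is copied by `Z` and the counit of `Z` is
copied by `X`. -/
structure StronglyComplementary {A : C} (Z X : DaggerQSCFA A) : Prop where
  bialgebra : X.mul ≫ Z.comul =
    (Z.comul ⊗ₘ Z.comul) ≫ tensorμ A A A A ≫ (X.mul ⊗ₘ X.mul)
  unit_copy : X.one ≫ Z.comul = (λ_ (𝟙_ C)).inv ≫ (X.one ⊗ₘ X.one)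
  counit_copy : X.mul ≫ Z.counit = (Z.counit ⊗ₘ Z.counit) ≫ (λ_ (𝟙_ C)).hom

/-! ### The phase group and the classical points -/

/-- A phase state of `Z`: a state `α` such that multiplying `α` with its conjugate gives the unit
of `Z`; the conjugate is attached as the effect `α†` on a leg of the `Z`-node. -/
@[ext]
structure Phase {A : C} (Z : DaggerQSCFA A) where
  state : 𝟙_ C ⟶ A
  isPhase : state ≫ Z.comul ≫ dag state ▷ A ≫ (λ_ A).hom = Z.one

namespace DaggerQSCFA

variable {A : C} (Z : DaggerQSCFA A)

theorem dag_phaseMap (a : 𝟙_ C ⟶ A) :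
    dag (Z.phaseMap a) = Z.comul ≫ dag a ▷ A ≫ (λ_ A).hom := by
  simp only [phaseMap, comul, dag_comp, dag_whiskerRight, dag_leftUnitor_inv, Category.assoc]

theorem one_phaseMap (a : 𝟙_ C ⟶ A) : Z.one ≫ Z.phaseMap a = a := by
  have h : Z.one ≫ Z.phaseMap a = (λ_ (𝟙_ C)).inv ≫ a ▷ 𝟙_ C ≫ A ◁ Z.one ≫ Z.mul := by
    rw [← whisker_exchange_assoc, phaseMap, leftUnitor_inv_naturality_assoc]
  rw [h, Z.mul_one, rightUnitor_naturality, ← unitors_equal, Iso.inv_hom_id_assoc]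

theorem phaseMap_one : Z.phaseMap Z.one = 𝟙 A := by
  rw [phaseMap, Z.one_mul, Iso.inv_hom_id]

/-- Maps commuting with right multiplication. -/
def RightLinear (f : A ⟶ A) : Prop := Z.mul ≫ f = f ▷ A ≫ Z.mul

variable {Z}

theorem RightLinear.comp {f g : A ⟶ A} (hf : Z.RightLinear f) (hg : Z.RightLinear g) :
    Z.RightLinear (f ≫ g) := by
  unfold RightLinear at *
  rw [← Category.assoc, hf, Category.assoc, hg, comp_whiskerRight, Category.assoc]

theorem RightLinear.eq_phaseMap {f : A ⟶ A} (hf : Z.RightLinear f) :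
    f = Z.phaseMap (Z.one ≫ f) := by
  unfold RightLinear at hf
  rw [phaseMap, comp_whiskerRight, Category.assoc, ← hf, ← Category.assoc (Z.one ▷ A), Z.one_mul,
    Iso.inv_hom_id_assoc]

variable (Z)

theorem rightLinear_id : Z.RightLinear (𝟙 A) := by
  simp [RightLinear]

theorem rightLinear_phaseMap (a : 𝟙_ C ⟶ A) : Z.RightLinear (Z.phaseMap a) := by
  unfold RightLinear phaseMap
  simp only [comp_whiskerRight, Category.assoc, Z.mul_assoc]
  rw [leftUnitor_inv_naturality_assoc, whisker_exchange_assoc]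
  simp

theorem rightLinear_dag_phaseMap (a : 𝟙_ C ⟶ A) : Z.RightLinear (dag (Z.phaseMap a)) := by
  unfold RightLinear
  rw [dag_phaseMap]
  have h := Z.frobenius_right
  simp only [comul, comp_whiskerRight, Category.assoc]
  rw [← Category.assoc Z.mul, ← h]
  simp only [Category.assoc]
  rw [whisker_exchange_assoc]
  simp

variable {Z}

theorem phase_phaseMap_dag (α : Phase Z) :
    Z.phaseMap α.state ≫ dag (Z.phaseMap α.state) = 𝟙 A := by
  rw [((Z.rightLinear_phaseMap _).comp (Z.rightLinear_dag_phaseMap _)).eq_phaseMap,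
    ← Category.assoc, one_phaseMap, dag_phaseMap, α.isPhase, phaseMap_one]

theorem phaseMap_phaseMap (a b : 𝟙_ C ⟶ A) :
    Z.phaseMap b ≫ Z.phaseMap a = Z.phaseMap (b ≫ Z.phaseMap a) := by
  rw [((Z.rightLinear_phaseMap b).comp (Z.rightLinear_phaseMap a)).eq_phaseMap,
    ← Category.assoc, one_phaseMap]

theorem phaseMap_eq (a : 𝟙_ C ⟶ A) : Z.phaseMap a = (ρ_ A).inv ≫ A ◁ a ≫ Z.mul := by
  have h : a ▷ A ≫ Z.mul = (β_ (𝟙_ C) A).hom ≫ A ◁ a ≫ Z.mul := by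
    conv_lhs => rw [← Z.mul_comm]
    rw [BraidedCategory.braiding_naturality_left_assoc]
  rw [phaseMap, h, leftUnitor_inv_braiding_assoc]

theorem comp_phaseMap_comm (a b : 𝟙_ C ⟶ A) : b ≫ Z.phaseMap a = a ≫ Z.phaseMap b := by
  rw [phaseMap_eq b, phaseMap, leftUnitor_inv_naturality_assoc, rightUnitor_inv_naturality_assoc,
    whisker_exchange_assoc, unitors_inv_equal]

theorem dag_phaseMap_eq (a : 𝟙_ C ⟶ A) :
    dag (Z.phaseMap a) = Z.phaseMap (Z.one ≫ dag (Z.phaseMap a)) :=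
  (Z.rightLinear_dag_phaseMap a).eq_phaseMap

theorem phase_dag_phaseMap (α : Phase Z) :
    dag (Z.phaseMap α.state) ≫ Z.phaseMap α.state = 𝟙 A := by
  have h := phase_phaseMap_dag α
  rw [dag_phaseMap_eq, phaseMap_phaseMap] at h ⊢
  rwa [comp_phaseMap_comm]

theorem isPhase_iff (a : 𝟙_ C ⟶ A) :
    a ≫ Z.comul ≫ dag a ▷ A ≫ (λ_ A).hom = Z.one ↔ a ≫ dag (Z.phaseMap a) = Z.one := by
  rw [dag_phaseMap]

end DaggerQSCFA

namespace Phase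

variable {A : C} {Z : DaggerQSCFA A}

/-- The sum of two phases is the state obtained by multiplying them with `Z`. -/
instance : Add (Phase Z) where
  add a b :=
    { state := (λ_ (𝟙_ C)).inv ≫ (a.state ⊗ₘ b.state) ≫ Z.mul
      isPhase := by
        have h : (λ_ (𝟙_ C)).inv ≫ (a.state ⊗ₘ b.state) ≫ Z.mul =
            b.state ≫ Z.phaseMap a.state := by
          rw [DaggerQSCFA.phaseMap, leftUnitor_inv_naturality_assoc, tensorHom_def',
            Category.assoc]
        rw [h, DaggerQSCFA.isPhase_iff, ← DaggerQSCFA.phaseMap_phaseMap, dag_comp,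
          Category.assoc, ← Category.assoc (Z.phaseMap a.state),
          DaggerQSCFA.phase_phaseMap_dag, Category.id_comp, DaggerQSCFA.dag_phaseMap, b.isPhase] }

/-- The zero phase is the unit of `Z`. -/
instance : Zero (Phase Z) where
  zero :=
    { state := Z.one
      isPhase := by
        rw [DaggerQSCFA.isPhase_iff, DaggerQSCFA.phaseMap_one, dag_id, Category.comp_id] }

/-- The inverse of a phase is its conjugate. -/
instance : Neg (Phase Z) where
  neg a :=
    { state := Z.one ≫ Z.comul ≫ dag a.state ▷ A ≫ (λ_ A).hom
      isPhase := by
        rw [← DaggerQSCFA.dag_phaseMap, DaggerQSCFA.isPhase_iff, ← DaggerQSCFA.dag_phaseMap_eq,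
          dag_dag, Category.assoc, DaggerQSCFA.phase_dag_phaseMap, Category.comp_id] }

theorem add_state_def (a b : Phase Z) :
    (a + b).state = (λ_ (𝟙_ C)).inv ≫ (a.state ⊗ₘ b.state) ≫ Z.mul := rfl

theorem zero_state (Z : DaggerQSCFA A) : (0 : Phase Z).state = Z.one := rfl

theorem add_state (a b : Phase Z) : (a + b).state = b.state ≫ Z.phaseMap a.state := by
  rw [add_state_def, DaggerQSCFA.phaseMap, leftUnitor_inv_naturality_assoc, tensorHom_def',
    Category.assoc]

theorem neg_state (a : Phase Z) : (-a).state = Z.one ≫ dag (Z.phaseMap a.state) := by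
  rw [DaggerQSCFA.dag_phaseMap]; rfl

theorem phaseMap_neg (a : Phase Z) : Z.phaseMap (-a).state = dag (Z.phaseMap a.state) := by
  rw [neg_state, ← DaggerQSCFA.dag_phaseMap_eq]

theorem add_comm' (a b : Phase Z) : a + b = b + a := by
  ext; rw [add_state, add_state, DaggerQSCFA.comp_phaseMap_comm]

theorem zero_add' (a : Phase Z) : 0 + a = a := by
  ext; rw [add_state, zero_state, DaggerQSCFA.phaseMap_one, Category.comp_id]

theorem neg_add' (a : Phase Z) : -a + a = 0 := by
  ext
  rw [add_comm', add_state, neg_state, Category.assoc, DaggerQSCFA.phase_dag_phaseMap,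
    Category.comp_id, zero_state]

theorem add_assoc' (a b c : Phase Z) : a + b + c = a + (b + c) := by
  ext
  rw [add_state, add_state, add_state, add_state, ← DaggerQSCFA.phaseMap_phaseMap, Category.assoc]

/-- The phase group of `Z`, written additively. -/
instance : AddCommGroup (Phase Z) where
  add_assoc := add_assoc'
  zero_add := zero_add'
  add_zero a := by rw [add_comm', zero_add']
  neg_add_cancel := neg_add'
  add_comm := add_comm'
  nsmul := nsmulRec
  zsmul := zsmulRec

end Phase

/-- A state is classical for `X` when it is copied by the comultiplication of `X`. -/
def IsCopyable {A : C} (X : DaggerQSCFA A) (a : 𝟙_ C ⟶ A) : Prop :=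
  a ≫ X.comul = (λ_ (𝟙_ C)).inv ≫ (a ⊗ₘ a)

namespace StronglyComplementary

variable {A : C} {Z X : DaggerQSCFA A}

theorem dag_bialgebra (h : StronglyComplementary Z X) : Z.mul ≫ X.comul =
    (X.comul ⊗ₘ X.comul) ≫ tensorμ A A A A ≫ (Z.mul ⊗ₘ Z.mul) := by
  have := congrArg dag h.bialgebra
  simpa only [DaggerQSCFA.comul, dag_comp, dag_dag, dag_tensor, dag_tensorμ, Category.assoc]
    using this

theorem one_copyable (h : StronglyComplementary Z X) : IsCopyable X Z.one := by
  have := congrArg dag h.counit_copy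
  simpa only [DaggerQSCFA.comul, DaggerQSCFA.counit, dag_comp, dag_dag, dag_tensor,
    dag_leftUnitor, IsCopyable] using this

theorem phaseMap_comul (h : StronglyComplementary Z X) {a : 𝟙_ C ⟶ A} (ha : IsCopyable X a) :
    Z.phaseMap a ≫ X.comul = X.comul ≫ (Z.phaseMap a ⊗ₘ Z.phaseMap a) := by
  unfold IsCopyable at ha
  have h1 : a ▷ A ≫ (X.comul ⊗ₘ X.comul) =
      𝟙_ C ◁ X.comul ≫ (λ_ (𝟙_ C)).inv ▷ (A ⊗ A) ≫ (a ⊗ₘ a) ▷ (A ⊗ A) := by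
    rw [← comp_whiskerRight, ← ha, tensorHom_def', comp_whiskerRight, whisker_exchange_assoc]
  have h2 : (λ_ (A ⊗ A)).inv ≫ (λ_ (𝟙_ C)).inv ▷ (A ⊗ A) ≫ tensorμ (𝟙_ C) (𝟙_ C) A A =
      (λ_ A).inv ⊗ₘ (λ_ A).inv := by
    rw [← cancel_mono ((λ_ A).hom ⊗ₘ (λ_ A).hom), Category.assoc, Category.assoc,
      ← tensor_left_unitality, Iso.inv_hom_id, tensorHom_comp_tensorHom, Iso.inv_hom_id,
      id_tensorHom_id]
  simp only [DaggerQSCFA.phaseMap, Category.assoc, h.dag_bialgebra]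
  rw [← Category.assoc (a ▷ A), h1]
  simp only [Category.assoc, tensorμ_natural_left_assoc]
  rw [← leftUnitor_inv_naturality_assoc]
  congr 1
  have h3 := congrArg (fun f => f ≫ (a ▷ A ⊗ₘ a ▷ A) ≫ (Z.mul ⊗ₘ Z.mul)) h2
  simp only [Category.assoc] at h3
  rw [h3, tensorHom_comp_tensorHom, tensorHom_comp_tensorHom]

theorem copyable_of_comul {a : 𝟙_ C ⟶ A} (h1 : IsCopyable X Z.one)
    (ha : Z.phaseMap a ≫ X.comul = X.comul ≫ (Z.phaseMap a ⊗ₘ Z.phaseMap a)) :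
    IsCopyable X a := by
  unfold IsCopyable at *
  have h2 : a ≫ X.comul = Z.one ≫ Z.phaseMap a ≫ X.comul := by
    rw [← Category.assoc, DaggerQSCFA.one_phaseMap]
  rw [h2, ha, ← Category.assoc, h1, Category.assoc, tensorHom_comp_tensorHom,
    DaggerQSCFA.one_phaseMap]

/-- The subgroup of the phase group of `Z` formed by the classical points of `X`. -/
def classicalSubgroup (h : StronglyComplementary Z X) : AddSubgroup (Phase Z) where
  carrier := {a | IsCopyable X a.state}
  zero_mem' := h.one_copyable
  add_mem' {a b} ha hb := by
    apply copyable_of_comul h.one_copyable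
    rw [Phase.add_state, ← DaggerQSCFA.phaseMap_phaseMap, Category.assoc, h.phaseMap_comul ha,
      ← Category.assoc, h.phaseMap_comul hb, Category.assoc, tensorHom_comp_tensorHom]
  neg_mem' {a} ha := by
    apply copyable_of_comul h.one_copyable
    have h1 := h.phaseMap_comul ha
    rw [Phase.phaseMap_neg]
    have h2 := congrArg (fun f => dag (Z.phaseMap a.state) ≫ f ≫
      (dag (Z.phaseMap a.state) ⊗ₘ dag (Z.phaseMap a.state))) h1
    simp only [Category.assoc, tensorHom_comp_tensorHom, DaggerQSCFA.phase_phaseMap_dag,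
      id_tensorHom_id, Category.comp_id] at h2
    rw [← h2, ← Category.assoc, DaggerQSCFA.phase_dag_phaseMap, Category.id_comp]

end StronglyComplementary

/-! ### Tensor powers -/

/-- The tensor power `B ⊗ (B ⊗ (⋯ ⊗ 𝟙_))` with `n` factors. -/
@[reducible] def pow (B : C) : ℕ → C
  | 0 => 𝟙_ C
  | n + 1 => B ⊗ pow B n

/-- The tensor product of a family of maps. -/
def powMap {B D : C} : (n : ℕ) → (Fin n → (B ⟶ D)) → (pow B n ⟶ pow D n)
  | 0, _ => 𝟙 (𝟙_ C)
  | n + 1, f => f 0 ⊗ₘ powMap n (fun i => f i.succ)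

/-- Apply the copying map `δ` to each factor and collect the first and the second copies. -/
def powComul {B : C} (δ : B ⟶ B ⊗ B) : (n : ℕ) → (pow B n ⟶ pow B n ⊗ pow B n)
  | 0 => (λ_ (𝟙_ C)).inv
  | n + 1 => (δ ⊗ₘ powComul δ n) ≫ tensorμ B B (pow B n) (pow B n)

/-- Apply the discarding map `ε` to each factor. -/
def powCounit {B : C} (ε : B ⟶ 𝟙_ C) : (n : ℕ) → (pow B n ⟶ 𝟙_ C)
  | 0 => 𝟙 (𝟙_ C)
  | n + 1 => (ε ⊗ₘ powCounit ε n) ≫ (λ_ (𝟙_ C)).hom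

/-- Keep the `i`-th factor and apply the discarding map `ε` to every other factor. -/
def keep {B : C} (ε : B ⟶ 𝟙_ C) : (n : ℕ) → Fin n → (pow B n ⟶ B)
  | 0, i => i.elim0
  | n + 1, i =>
    Fin.cases (B ◁ powCounit ε n ≫ (ρ_ B).hom) (fun j => (ε ⊗ₘ keep ε n j) ≫ (λ_ B).hom) i

/-- Given a copying map and a discarding map on `W`, copy the input `n` times and apply `f i` to
the `i`-th copy. -/
def fanOut {W B : C} (δ : W ⟶ W ⊗ W) (ε : W ⟶ 𝟙_ C) :
    (n : ℕ) → (Fin n → (W ⟶ B)) → (W ⟶ pow B n)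
  | 0, _ => ε
  | n + 1, f => δ ≫ (f 0 ⊗ₘ fanOut δ ε n (fun i => f i.succ))

/-! ### Mermin measurements and scenarios -/

/-- The `N`-partite GHZ state of `Z`: the unit of `Z` followed by the `Z`-node with `N` outputs. -/
def ghz {A : C} (Z : DaggerQSCFA A) (N : ℕ) : 𝟙_ C ⟶ pow A N :=
  Z.one ≫ fanOut Z.comul Z.counit N (fun _ => 𝟙 A)

/-- The outcome state of measuring each of the `N` factors of a state `ψ` in the observable `X`:
each factor of `ψ` enters an `X`-node with one output and with one leg connected to the
corresponding factor of the conjugate of `ψ` (which, its wires being reversed, is the effect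
`ψ†`). -/
def measure {A : C} (X : DaggerQSCFA A) (N : ℕ) (ψ : 𝟙_ C ⟶ pow A N) : 𝟙_ C ⟶ pow A N :=
  ψ ≫ powComul X.comul N ≫ dag ψ ▷ pow A N ≫ (λ_ (pow A N)).hom

/-- The outcome state of the Mermin measurement with phases `α`: the phases are applied to the
factors of a GHZ state of `Z`, and then each factor is measured in `X`. -/
def merminMeasurement {A : C} (Z X : DaggerQSCFA A) {N : ℕ} (α : Fin N → Phase Z) :
    𝟙_ C ⟶ pow A N :=
  measure X N (ghz Z N ≫ powMap N (fun i => Z.phaseMap (α i).state))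

/-- An `N`-partite Mermin measurement scenario: a non-empty finite family of Mermin measurements,
in each of which the phases add up to a classical point of `X`. -/
structure MerminScenario {A : C} {Z X : DaggerQSCFA A} (h : StronglyComplementary Z X)
    (N : ℕ) where
  S : ℕ
  S_pos : 0 < S
  phase : Fin S → Fin N → Phase Z
  sum_mem : ∀ s, ∑ i, phase s i ∈ h.classicalSubgroup

namespace MerminScenario

variable {A : C} {Z X : DaggerQSCFA A} {h : StronglyComplementary Z X} {N : ℕ}

/-- The set of the phases appearing in the scenario. -/
def phases (m : MerminScenario h N) : Set (Phase Z) :=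
  Set.range fun p : Fin m.S × Fin N => m.phase p.1 p.2

/-- The number `M` of distinct phases appearing in the scenario. -/
noncomputable def M (m : MerminScenario h N) : ℕ := Nat.card m.phases

theorem finite_phases (m : MerminScenario h N) : Finite m.phases := Set.finite_range _

/-- The index `r` for which the `i`-th phase of measurement `s` is the distinct phase `a_r`, in a
fixed enumeration `a_1, …, a_M` of the distinct phases of the scenario. -/
noncomputable def index (m : MerminScenario h N) (s : Fin m.S) (i : Fin N) : Fin m.M :=
  haveI := m.finite_phases
  Finite.equivFin m.phases ⟨m.phase s i, ⟨(s, i), rfl⟩⟩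

/-- The local map of the scenario, from `N` groups (the systems) of `M` wires to `S` groups (the
measurements) of `N` wires. Each input wire is copied with `X`; the `i`-th output wire of
measurement `s` is a copy of the `r`-th wire of system `i`, where `a_r` is the `i`-th phase of
measurement `s`. (Copies that are not used are discarded by the counit of `X`, so each input wire
enters an `X`-node whose outputs are exactly the output wires connected to it.) -/
noncomputable def localMap (m : MerminScenario h N) :
    pow (pow A m.M) N ⟶ pow (pow A N) m.S :=
  let δ := powComul (powComul X.comul m.M) N
  let ε := powCounit (powCounit X.counit m.M) N
  fanOut δ ε m.S fun s => fanOut δ ε N fun i =>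
    keep (powCounit X.counit m.M) N i ≫ keep X.counit m.M (m.index s i)

/-- The scenario has a local hidden variable model: for some state `Λ'` the local map yields a
state from which each measurement `s` of the scenario is recovered by discarding, with the counit
of `X`, the output wires of all the other measurements. -/
def HasLocalHiddenVariableModel (m : MerminScenario h N) : Prop :=
  ∃ Λ' : 𝟙_ C ⟶ pow (pow A m.M) N, ∀ s : Fin m.S,
    merminMeasurement Z X (m.phase s) =
      (Λ' ≫ m.localMap) ≫ keep (powCounit X.counit N) m.S s

end MerminScenario

end Basics

/-- A dagger symmetric monoidal category is Mermin local when every Mermin measurement scenario,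
for every strongly complementary pair in it, has a local hidden variable model. -/
def IsMerminLocal (C : Type u) [Category.{v} C] [MonoidalCategory C] [SymmetricCategory C]
    [DaggerSMC C] : Prop :=
  ∀ (A : C) (Z X : DaggerQSCFA A) (h : StronglyComplementary Z X) (N : ℕ)
    (m : MerminScenario h N), m.HasLocalHiddenVariableModel

/-- `G` is a non-trivial algebraic extension of `H` when some finite system of integer linear
equations with right-hand sides in `H` has a solution in `G` but none in `H`. -/
def IsNontrivialAlgebraicExtension {G : Type*} [AddCommGroup G] (H : AddSubgroup G) : Prop :=
  ∃ (k l : ℕ) (n : Fin k → Fin l → ℤ) (c : Fin k → G), (∀ p, c p ∈ H) ∧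
    (∃ x : Fin l → G, ∀ p, ∑ j, n p j • x j = c p) ∧
    ¬ ∃ x : Fin l → G, (∀ j, x j ∈ H) ∧ ∀ p, ∑ j, n p j • x j = c p

/-- `G` is a trivial algebraic extension of `H` when it is not a non-trivial one. -/
def IsTrivialAlgebraicExtension {G : Type*} [AddCommGroup G] (H : AddSubgroup G) : Prop :=
  ¬ IsNontrivialAlgebraicExtension H

end Mermin

/-! Phases slide along the legs of a `Z`-node, so the state being measured depends on `α` only
through `∑ i, α i` (`ghz_comp_powMap`). The phases of a measurement may therefore be replaced by any
others with the same sum. The equations `∑ i, x (i, index s i) = ∑ i, phase s i`, one per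
measurement, with one unknown for each pair (system, phase), are solved in the phase group by giving
the pair `(i, r)` the phase `a_r`. Their right-hand sides are classical, so triviality of the
extension yields classical values `κ i r` (`exists_classical_values`). A classical phase acts as a
unitary that `X` copies, so it passes through the measurement (`measure_comp_powMap`): every outcome
is one fixed outcome, that of the bare GHZ state, with `κ i (index s i)` applied to wire `i`
(`merminMeasurement_eq`). The hidden state copies each wire of this fixed outcome with `X` and
applies `κ i r` to the `r`-th copy. The local map followed by discarding selects the copies
belonging to one measurement (`localMap_keep`), and the unused copies vanish because classical
phases preserve the counit of `X` (`phaseMap_counit`). -/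

namespace Mermin

/-! ### Copying and discarding with a counital pair. -/

section Monoidal

variable {C : Type u} [Category.{v} C] [MonoidalCategory C]

/-- A copying map `δ` and a discarding map `ε` satisfying the two counit laws. -/
structure IsCounital {W : C} (δ : W ⟶ W ⊗ W) (ε : W ⟶ 𝟙_ C) : Prop where
  left : δ ≫ (ε ⊗ₘ 𝟙 W) = (λ_ W).inv
  right : δ ≫ (𝟙 W ⊗ₘ ε) = (ρ_ W).inv

theorem IsCounital.comul_left {W B : C} {δ : W ⟶ W ⊗ W} {ε : W ⟶ 𝟙_ C} (h : IsCounital δ ε)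
    (g : W ⟶ B) : δ ≫ (ε ⊗ₘ g) = g ≫ (λ_ B).inv := by
  have : (ε ⊗ₘ g) = (ε ⊗ₘ 𝟙 W) ≫ (𝟙 (𝟙_ C) ⊗ₘ g) := by
    rw [tensorHom_comp_tensorHom, Category.comp_id, Category.id_comp]
  rw [this, ← Category.assoc, h.left, id_tensorHom, leftUnitor_inv_naturality]

theorem IsCounital.comul_right {W B : C} {δ : W ⟶ W ⊗ W} {ε : W ⟶ 𝟙_ C} (h : IsCounital δ ε)
    (g : W ⟶ B) : δ ≫ (g ⊗ₘ ε) = g ≫ (ρ_ B).inv := by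
  have : (g ⊗ₘ ε) = (𝟙 W ⊗ₘ ε) ≫ (g ⊗ₘ 𝟙 (𝟙_ C)) := by
    rw [tensorHom_comp_tensorHom, Category.comp_id, Category.id_comp]
  rw [this, ← Category.assoc, h.right, tensorHom_id, rightUnitor_inv_naturality]

theorem keep_counit {B : C} (ε : B ⟶ 𝟙_ C) :
    ∀ (n : ℕ) (i : Fin n), keep ε n i ≫ ε = powCounit ε n
  | 0, i => i.elim0
  | n + 1, i => by
    refine Fin.cases ?_ (fun j => ?_) i
    · simp only [keep, Fin.cases_zero, powCounit, Category.assoc]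
      rw [← rightUnitor_naturality, ← unitors_equal, tensorHom_def', Category.assoc]
    · simp only [keep, Fin.cases_succ, powCounit, Category.assoc]
      rw [← leftUnitor_naturality, ← id_tensorHom, tensorHom_comp_tensorHom_assoc,
        keep_counit ε n j, Category.comp_id]

theorem fanOut_counit {W B : C} {δ : W ⟶ W ⊗ W} {ε : W ⟶ 𝟙_ C} (h : IsCounital δ ε)
    {ε' : B ⟶ 𝟙_ C} : ∀ (n : ℕ) (f : Fin n → (W ⟶ B)), (∀ i, f i ≫ ε' = ε) →
      fanOut δ ε n f ≫ powCounit ε' n = ε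
  | 0, _, _ => by simp [fanOut, powCounit]
  | n + 1, f, hf => by
    rw [fanOut, powCounit, Category.assoc, tensorHom_comp_tensorHom_assoc, hf,
      fanOut_counit h n _ fun i => hf i.succ, reassoc_of% h.comul_left]
    simp

/-- Once the discarded branches collapse to `ε`, the counit laws remove them one by one.
Coassociativity plays no role. -/
theorem fanOut_keep {W B : C} {δ : W ⟶ W ⊗ W} {ε : W ⟶ 𝟙_ C} (h : IsCounital δ ε)
    {ε' : B ⟶ 𝟙_ C} : ∀ (n : ℕ) (f : Fin n → (W ⟶ B)), (∀ i, f i ≫ ε' = ε) →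
      ∀ i, fanOut δ ε n f ≫ keep ε' n i = f i
  | 0, _, _, i => i.elim0
  | n + 1, f, hf, i => by
    refine Fin.cases ?_ (fun j => ?_) i
    · rw [fanOut, keep, Fin.cases_zero, ← id_tensorHom, Category.assoc,
        tensorHom_comp_tensorHom_assoc, fanOut_counit h n _ fun i => hf i.succ, Category.comp_id,
        reassoc_of% h.comul_right]
      simp
    · rw [fanOut, keep, Fin.cases_succ, Category.assoc, tensorHom_comp_tensorHom_assoc, hf,
        fanOut_keep h n _ (fun i => hf i.succ) j, reassoc_of% h.comul_left]
      simp

theorem fanOut_natural {V W B : C} {δ : V ⟶ V ⊗ V} {ε : V ⟶ 𝟙_ C} {δ' : W ⟶ W ⊗ W}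
    {ε' : W ⟶ 𝟙_ C} {q : V ⟶ W} (hδ : q ≫ δ' = δ ≫ (q ⊗ₘ q)) (hε : q ≫ ε' = ε) :
    ∀ (n : ℕ) (f : Fin n → (W ⟶ B)), fanOut δ ε n (fun i => q ≫ f i) = q ≫ fanOut δ' ε' n f
  | 0, _ => hε.symm
  | n + 1, f => by
    rw [fanOut, fanOut, fanOut_natural hδ hε n, reassoc_of% hδ, tensorHom_comp_tensorHom]

theorem powMap_comp {B D E : C} : ∀ (n : ℕ) (f : Fin n → (B ⟶ D)) (g : Fin n → (D ⟶ E)),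
    powMap n f ≫ powMap n g = powMap n fun i => f i ≫ g i
  | 0, _, _ => Category.id_comp _
  | n + 1, f, g => by
    rw [powMap, powMap, powMap, tensorHom_comp_tensorHom, powMap_comp n]

theorem powMap_id (B : C) : ∀ n, powMap n (fun _ => 𝟙 B) = 𝟙 (pow B n)
  | 0 => rfl
  | n + 1 => by rw [powMap, powMap_id B n, id_tensorHom_id]

end Monoidal

/-! ### Copying and discarding on tensor powers. -/

section Symmetric

variable {C : Type u} [Category.{v} C] [MonoidalCategory C] [SymmetricCategory C]

theorem tensorμ_unit_unit (B D : C) :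
    tensorμ B (𝟙_ C) (𝟙_ C) D ≫ ((ρ_ B).hom ⊗ₘ (λ_ D).hom) = (ρ_ B).hom ⊗ₘ (λ_ D).hom := by
  have h : (β_ (𝟙_ C) (𝟙_ C)).hom = 𝟙 _ := by
    rw [← cancel_mono (λ_ (𝟙_ C)).hom, braiding_leftUnitor, unitors_equal, Category.id_comp]
  simp [tensorμ, h]

theorem isCounital_powComul {B : C} {δ : B ⟶ B ⊗ B} {ε : B ⟶ 𝟙_ C} (h : IsCounital δ ε) :
    ∀ n, IsCounital (powComul δ n) (powCounit ε n)
  | 0 => ⟨by simp [powComul, powCounit], by simp [powComul, powCounit, unitors_inv_equal]⟩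
  | n + 1 => by
    have ih := isCounital_powComul h n
    constructor
    · have h1 : (powCounit ε (n + 1) ⊗ₘ 𝟙 (pow B (n + 1))) =
          ((ε ⊗ₘ powCounit ε n) ⊗ₘ (𝟙 B ⊗ₘ 𝟙 (pow B n))) ≫
            (λ_ (𝟙_ C)).hom ▷ (B ⊗ pow B n) := by
        rw [← tensorHom_id, tensorHom_comp_tensorHom, id_tensorHom_id, Category.comp_id, powCounit]
      rw [h1, powComul, Category.assoc, ← tensorμ_natural_assoc, tensorHom_comp_tensorHom_assoc,
        h.left, ih.left, ← cancel_mono (λ_ (B ⊗ pow B n)).hom]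
      simp only [Category.assoc]
      rw [← leftUnitor_monoidal, tensorHom_comp_tensorHom, Iso.inv_hom_id, Iso.inv_hom_id,
        Iso.inv_hom_id, id_tensorHom_id]
    · have h1 : (𝟙 (pow B (n + 1)) ⊗ₘ powCounit ε (n + 1)) =
          ((𝟙 B ⊗ₘ 𝟙 (pow B n)) ⊗ₘ (ε ⊗ₘ powCounit ε n)) ≫
            (B ⊗ pow B n) ◁ (λ_ (𝟙_ C)).hom := by
        rw [← id_tensorHom, tensorHom_comp_tensorHom, id_tensorHom_id, Category.comp_id, powCounit]
      rw [h1, powComul, Category.assoc, ← tensorμ_natural_assoc, tensorHom_comp_tensorHom_assoc,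
        h.right, ih.right, ← cancel_mono (ρ_ (B ⊗ pow B n)).hom]
      simp only [Category.assoc]
      rw [← rightUnitor_monoidal, tensorHom_comp_tensorHom, Iso.inv_hom_id, Iso.inv_hom_id,
        Iso.inv_hom_id, id_tensorHom_id]

/-- Discarding the head respects copying because `δ ≫ (ε ⊗ₘ ε) = ε ≫ (λ_ _).inv`, a case of the left
counit law. This lets `fanOut_natural` pull the projection onto the tail out of a fan. -/
theorem powComul_discard_head {B : C} {δ : B ⟶ B ⊗ B} {ε : B ⟶ 𝟙_ C} (h : IsCounital δ ε)
    (n : ℕ) : ((ε ⊗ₘ 𝟙 (pow B n)) ≫ (λ_ (pow B n)).hom) ≫ powComul δ n =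
      powComul δ (n + 1) ≫ (((ε ⊗ₘ 𝟙 (pow B n)) ≫ (λ_ (pow B n)).hom) ⊗ₘ
        ((ε ⊗ₘ 𝟙 (pow B n)) ≫ (λ_ (pow B n)).hom)) := by
  rw [← tensorHom_comp_tensorHom, powComul, Category.assoc, Category.assoc, ← tensorμ_natural_assoc,
    tensorHom_comp_tensorHom_assoc, h.comul_left, id_tensorHom_id, Category.comp_id]
  have h1 : (ε ≫ (λ_ (𝟙_ C)).inv ⊗ₘ powComul δ n) =
      (ε ⊗ₘ powComul δ n) ≫ (λ_ (𝟙_ C)).inv ▷ (pow B n ⊗ pow B n) := by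
    rw [← tensorHom_id, tensorHom_comp_tensorHom, Category.comp_id]
  rw [h1, Category.assoc, ← tensor_left_unitality, ← leftUnitor_naturality,
    ← id_tensorHom, tensorHom_comp_tensorHom_assoc, Category.comp_id, Category.id_comp]

/-- By induction: all copies but the first ignore the head, so their fan factors through the tail.
What remains is one copying step whose superfluous head and tail are removed by the counit laws. -/
theorem fanOut_keep_eq_powMap {B D : C} {δ : B ⟶ B ⊗ B} {ε : B ⟶ 𝟙_ C} (h : IsCounital δ ε) :
    ∀ (n : ℕ) (f : Fin n → (B ⟶ D)),
      fanOut (powComul δ n) (powCounit ε n) n (fun i => keep ε n i ≫ f i) = powMap n f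
  | 0, _ => rfl
  | n + 1, f => by
    have h1 : (fun i : Fin n => keep ε (n + 1) i.succ ≫ f i.succ) = fun i =>
        ((ε ⊗ₘ 𝟙 (pow B n)) ≫ (λ_ (pow B n)).hom) ≫ keep ε n i ≫ f i.succ := by
      funext i
      rw [keep, Fin.cases_succ, Category.assoc, Category.assoc,
        ← leftUnitor_naturality_assoc (keep ε n i), ← id_tensorHom,
        tensorHom_comp_tensorHom_assoc, Category.comp_id, Category.id_comp]
    have h2 : ((ε ⊗ₘ 𝟙 (pow B n)) ≫ (λ_ (pow B n)).hom) ≫ powCounit ε n =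
        powCounit ε (n + 1) := by
      rw [Category.assoc, ← leftUnitor_naturality, ← id_tensorHom,
        tensorHom_comp_tensorHom_assoc, Category.comp_id, Category.id_comp, powCounit]
    rw [fanOut, h1, fanOut_natural (powComul_discard_head h n) h2, fanOut_keep_eq_powMap h n,
      ← tensorHom_comp_tensorHom, keep, Fin.cases_zero, ← tensorHom_comp_tensorHom,
      ← id_tensorHom, powComul, Category.assoc, Category.assoc, ← tensorμ_natural_assoc,
      tensorHom_comp_tensorHom_assoc, h.right, (isCounital_powComul h n).left,
      reassoc_of% tensorμ_unit_unit, tensorHom_comp_tensorHom_assoc, Iso.inv_hom_id,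
      Iso.inv_hom_id, id_tensorHom_id, Category.id_comp, powMap]

theorem powMap_comul {B : C} {δ : B ⟶ B ⊗ B} : ∀ (n : ℕ) (f : Fin n → (B ⟶ B)),
    (∀ i, f i ≫ δ = δ ≫ (f i ⊗ₘ f i)) →
      powMap n f ≫ powComul δ n = powComul δ n ≫ (powMap n f ⊗ₘ powMap n f)
  | 0, _, _ => by simp [powMap, powComul]
  | n + 1, f, hf => by
    rw [powMap, powComul, tensorHom_comp_tensorHom_assoc, hf,
      powMap_comul n _ fun i => hf i.succ, ← tensorHom_comp_tensorHom, Category.assoc,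
      Category.assoc, tensorμ_natural]

/-! ### Phases, measurements and the dagger. -/

variable [DaggerSMC C]

theorem dag_powMap {B D : C} : ∀ (n : ℕ) (f : Fin n → (B ⟶ D)),
    dag (powMap n f) = powMap n fun i => dag (f i)
  | 0, _ => dag_id _
  | n + 1, f => by rw [powMap, powMap, dag_tensor, dag_powMap n]

/-- Each `f i` is copied onto both legs of its `X`-node: the copy meeting the conjugate state
cancels against `dag (f i)`, the other one reaches the output. -/
theorem measure_comp_powMap {A : C} (X : DaggerQSCFA A) (N : ℕ) (ψ : 𝟙_ C ⟶ pow A N)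
    (f : Fin N → (A ⟶ A)) (hδ : ∀ i, f i ≫ X.comul = X.comul ≫ (f i ⊗ₘ f i))
    (hf : ∀ i, f i ≫ dag (f i) = 𝟙 A) :
    measure X N (ψ ≫ powMap N f) = measure X N ψ ≫ powMap N f := by
  have h1 : powMap N f ≫ dag (powMap N f) = 𝟙 _ := by
    rw [dag_powMap, powMap_comp]; simp only [hf, powMap_id]
  have h2 : (powMap N f ⊗ₘ powMap N f) ≫ dag (powMap N f) ▷ pow A N = pow A N ◁ powMap N f := by
    rw [← tensorHom_id, tensorHom_comp_tensorHom, h1, Category.comp_id, id_tensorHom]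
  simp only [measure, dag_comp, comp_whiskerRight, Category.assoc]
  rw [reassoc_of% powMap_comul N f hδ, reassoc_of% h2, whisker_exchange_assoc]
  simp

namespace DaggerQSCFA

variable {A : C} (X Z : DaggerQSCFA A)

theorem isCounital : IsCounital X.comul X.counit where
  left := by
    have := congrArg dag X.one_mul
    rwa [dag_comp, dag_whiskerRight, dag_leftUnitor, ← tensorHom_id] at this
  right := by
    have := congrArg dag X.mul_one
    rwa [dag_comp, dag_whiskerLeft, dag, dag, dag, DaggerSMC.dagger_rightUnitor,
      ← id_tensorHom] at this

/-- This is the dagger of the right linearity of `dag (Z.phaseMap a)`, hence a consequence of the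
Frobenius law. -/
theorem phaseMap_comul_left (a : 𝟙_ C ⟶ A) :
    Z.phaseMap a ≫ Z.comul = Z.comul ≫ Z.phaseMap a ▷ A := by
  have h := Z.rightLinear_dag_phaseMap a
  have h1 := congrArg dag h
  simpa only [comul, dag_comp, dag_whiskerRight, dag_dag] using h1

theorem comul_braiding : Z.comul ≫ (β_ A A).hom = Z.comul := by
  have h := congrArg dag Z.mul_comm
  rw [dag_comp, dag_braiding] at h
  rw [comul, SymmetricCategory.braiding_swap_eq_inv_braiding A A]
  exact h

theorem phaseMap_comul_right (a : 𝟙_ C ⟶ A) :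
    Z.phaseMap a ≫ Z.comul = Z.comul ≫ A ◁ Z.phaseMap a := by
  rw [← comul_braiding, reassoc_of% phaseMap_comul_left, Category.assoc,
    BraidedCategory.braiding_naturality_left]

theorem phaseMap_sum_fanOut : ∀ (N : ℕ) (α : Fin N → Phase Z),
    Z.phaseMap (∑ i, α i).state ≫ fanOut Z.comul Z.counit N (fun _ => 𝟙 A) =
      fanOut Z.comul Z.counit N (fun _ => 𝟙 A) ≫ powMap N fun i => Z.phaseMap (α i).state
  | 0, _ => by
    rw [Fin.sum_univ_zero, Phase.zero_state, phaseMap_one, Category.id_comp, powMap]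
    exact (Category.comp_id _).symm
  | N + 1, α => by
    -- The swap puts the tail's phase next to the comultiplication, so it takes the right leg and `α
    -- 0` the left one.
    rw [Fin.sum_univ_succ, add_comm (α 0), Phase.add_state, ← phaseMap_phaseMap, fanOut, powMap,
      Category.assoc, Category.assoc, reassoc_of% phaseMap_comul_right,
      reassoc_of% phaseMap_comul_left, tensorHom_comp_tensorHom, ← phaseMap_sum_fanOut N,
      ← id_tensorHom, ← tensorHom_id, tensorHom_comp_tensorHom_assoc, tensorHom_comp_tensorHom]
    simp

end DaggerQSCFA

theorem ghz_comp_powMap {A : C} (Z : DaggerQSCFA A) {N : ℕ} (α : Fin N → Phase Z) :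
    ghz Z N ≫ powMap N (fun i => Z.phaseMap (α i).state) =
      (∑ i, α i).state ≫ fanOut Z.comul Z.counit N (fun _ => 𝟙 A) := by
  rw [ghz, Category.assoc, ← Z.phaseMap_sum_fanOut, ← Category.assoc,
    DaggerQSCFA.one_phaseMap]

namespace StronglyComplementary

variable {A : C} {Z X : DaggerQSCFA A} (h : StronglyComplementary Z X)

/-- Since the phase map is copied by `X` and unitary, following it by the counit gives another right
counit for `X.comul`; the existing left counit forces the two to agree. -/
theorem phaseMap_counit {a : Phase Z} (ha : a ∈ h.classicalSubgroup) :
    Z.phaseMap a.state ≫ X.counit = X.counit := by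
  have h1 := h.phaseMap_comul ha
  have h2 : X.comul ≫ (𝟙 A ⊗ₘ Z.phaseMap a.state ≫ X.counit) = (ρ_ A).inv := by
    have h3 := congrArg (fun f => f ≫ (dag (Z.phaseMap a.state) ⊗ₘ X.counit)) h1
    simp only [Category.assoc, tensorHom_comp_tensorHom, DaggerQSCFA.phase_phaseMap_dag] at h3
    rw [← h3, X.isCounital.comul_right, ← Category.assoc, DaggerQSCFA.phase_phaseMap_dag,
      Category.id_comp]
  have h4 := congrArg (fun f => f ≫ (X.counit ⊗ₘ 𝟙 (𝟙_ C))) h2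
  simp only [Category.assoc, tensorHom_comp_tensorHom, Category.id_comp, Category.comp_id] at h4
  rw [X.isCounital.comul_left, tensorHom_id, ← rightUnitor_inv_naturality,
    ← unitors_inv_equal] at h4
  exact (cancel_mono _).1 h4

theorem merminMeasurement_eq {N : ℕ} {α κ : Fin N → Phase Z}
    (hκ : ∀ i, κ i ∈ h.classicalSubgroup) (hsum : ∑ i, κ i = ∑ i, α i) :
    merminMeasurement Z X α =
      measure X N (ghz Z N) ≫ powMap N fun i => Z.phaseMap (κ i).state := by
  rw [merminMeasurement, ghz_comp_powMap, ← hsum, ← ghz_comp_powMap]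
  exact measure_comp_powMap X N _ _ (fun i => h.phaseMap_comul (hκ i))
    fun i => DaggerQSCFA.phase_phaseMap_dag _

end StronglyComplementary

/-! ### The hidden variable model. -/

namespace MerminScenario

variable {A : C} {Z X : DaggerQSCFA A} {h : StronglyComplementary Z X} {N : ℕ}

theorem localMap_keep (m : MerminScenario h N) (s : Fin m.S) :
    m.localMap ≫ keep (powCounit X.counit N) m.S s =
      powMap N fun i => keep X.counit m.M (m.index s i) := by
  have hX := isCounital_powComul X.isCounital m.M
  have hXN := isCounital_powComul hX N
  rw [localMap, fanOut_keep hXN, fanOut_keep_eq_powMap hX]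
  -- The side condition of `fanOut_keep`: discarding all outputs of one measurement discards the
  -- whole input.
  intro s
  refine fanOut_counit hXN N _ fun i => ?_
  rw [Category.assoc, keep_counit, keep_counit]

/-- Classical values for the pairs of a system and a phase which have the right sum in every
measurement. -/
theorem exists_classical_values (m : MerminScenario h N)
    (htriv : IsTrivialAlgebraicExtension h.classicalSubgroup) :
    ∃ κ : Fin N → Fin m.M → Phase Z, (∀ i r, κ i r ∈ h.classicalSubgroup) ∧
      ∀ s, ∑ i, κ i (m.index s i) = ∑ i, m.phase s i := by
  have := m.finite_phases
  have key : ∀ (y : Fin N → Fin m.M → Phase Z) (s : Fin m.S),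
      ∑ j : Fin (N * m.M), (if (finProdFinEquiv.symm j).2 = m.index s (finProdFinEquiv.symm j).1
        then (1 : ℤ) else 0) • y (finProdFinEquiv.symm j).1 (finProdFinEquiv.symm j).2 =
      ∑ i, y i (m.index s i) := by
    intro y s
    rw [finProdFinEquiv.symm.sum_comp (fun p : Fin N × Fin m.M =>
      (if p.2 = m.index s p.1 then (1 : ℤ) else 0) • y p.1 p.2), Fintype.sum_prod_type]
    simp [ite_smul]
  by_contra hne
  -- Unknowns are pairs (system, phase) flattened by `finProdFinEquiv`; row `s` has coefficient 1
  -- exactly at the pairs `(i, index s i)`. The solution in the phase group ignores the system and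
  -- assigns to `r` the phase it enumerates.
  refine htriv ⟨m.S, N * m.M, fun s j => if (finProdFinEquiv.symm j).2 =
    m.index s (finProdFinEquiv.symm j).1 then 1 else 0, fun s => ∑ i, m.phase s i, m.sum_mem,
    ⟨fun j => ((Finite.equivFin m.phases).symm (finProdFinEquiv.symm j).2 : Phase Z),
      fun s => ?_⟩, ?_⟩
  · refine (key (fun _ r => ((Finite.equivFin m.phases).symm r : Phase Z)) s).trans ?_
    refine Finset.sum_congr rfl fun i _ => ?_
    rw [index, Equiv.symm_apply_apply]
  · rintro ⟨x, hx, hsum⟩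
    refine hne ⟨fun i r => x (finProdFinEquiv (i, r)), fun i r => hx _, fun s => ?_⟩
    refine Eq.trans ?_ (hsum s)
    rw [← key (fun i r => x (finProdFinEquiv (i, r))) s]
    simp only [Prod.mk.eta, Equiv.apply_symm_apply]

theorem hasLocalHiddenVariableModel (m : MerminScenario h N)
    (htriv : IsTrivialAlgebraicExtension h.classicalSubgroup) :
    m.HasLocalHiddenVariableModel := by
  obtain ⟨κ, hκ, hsum⟩ := m.exists_classical_values htriv
  -- The wire of system `i` becomes `M` correlated wires, the `r`-th carrying the classical value
  -- for phase `a_r`.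
  refine ⟨measure X N (ghz Z N) ≫ powMap N fun i =>
    fanOut X.comul X.counit m.M fun r => Z.phaseMap (κ i r).state, fun s => ?_⟩
  rw [Category.assoc, localMap_keep, Category.assoc, powMap_comp,
    h.merminMeasurement_eq (fun i => hκ i (m.index s i)) (hsum s)]
  congr 2
  funext i
  -- On each system only the branch `index s i` survives, the other branches being absorbed by the
  -- counit.
  exact (fanOut_keep X.isCounital m.M _ (fun r => h.phaseMap_counit (hκ i r)) _).symm

end MerminScenario

end Symmetric

end Mermin

theorem mainTheorem2 {C : Type u} [Category.{v} C] [MonoidalCategory C] [SymmetricCategory C]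
    [Mermin.DaggerSMC C]
    (hC : ∀ (A : C) (Z X : Mermin.DaggerQSCFA A) (h : Mermin.StronglyComplementary Z X),
      Mermin.IsTrivialAlgebraicExtension h.classicalSubgroup) :
    Mermin.IsMerminLocal C :=
  fun A Z X h _ m => m.hasLocalHiddenVariableModel (hC A Z X h)
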